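/- Fix an integer $n\ge 0$. For $\delta>1$, call a real number $\lambda$ a radial Neumann eigenvalue (of angular order $n$, on $1\le r\le\delta$) if the problem $$R''+\frac1r R'+\Big(\lambda-\frac{n^2}{r^2}\Big)R=0\quad\text{on }[1,\delta],\qquad R'(1)=R'(\delta)=0,$$ has a twice differentiable real-valued solution $R$ that is not identically zero. Then for every $\delta>1$ the set of all radial Neumann eigenvalues can be written as a sequence $(\lambda_{n,j})_{j\ge 1}$, $\lambda_{n,j}=\lambda_{n,j}(\delta)$, with $$0\le\lambda_{n,1}<\lambda_{n,2}<\lambda_{n,3}<\cdots,\qquad \lambda_{n,j}\to\infty\ \text{ as } j\to\infty .$$ For each fixed $j$, as $\delta\to1^+$, $$\lambda_{n,j}(\delta)\to\begin{cases} n^2, & j=1,\\ \infty, & j>1.\end{cases}$$ Moreover, if $n\ge1$, then $\lambda_{n,1}(\delta)>n^2/\delta^2$ for every $\delta>1$, while for $n=0$ one has $\lambda_{0,1}(\delta)=0$ for every $\delta>1$. -/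

import Mathlib

open Set Filter Topology

/-- `lam` is an eigenvalue of the radial Neumann problem of angular order `n` on `1 ≤ r ≤ δ`:
there is a function `R`, twice differentiable on `[1, δ]` (one-sidedly at the end points, with
first and second derivatives `R'` and `R''`), not identically zero on `[1, δ]`, such that
`R'' + r⁻¹ R' + (lam - n² / r²) R = 0` on `[1, δ]` and `R'(1) = R'(δ) = 0`. -/
def IsRadialNeumannEigenvalue (n : ℕ) (δ lam : ℝ) : Prop :=
  ∃ R R' R'' : ℝ → ℝ,
    (∀ r ∈ Icc 1 δ, HasDerivWithinAt R (R' r) (Icc 1 δ) r) ∧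
    (∀ r ∈ Icc 1 δ, HasDerivWithinAt R' (R'' r) (Icc 1 δ) r) ∧
    (∃ r ∈ Icc 1 δ, R r ≠ 0) ∧
    (∀ r ∈ Icc 1 δ, R'' r + r⁻¹ * R' r + (lam - (n : ℝ) ^ 2 / r ^ 2) * R r = 0) ∧
    R' 1 = 0 ∧ R' δ = 0

/-! The proof uses the Prüfer substitution `R = ρ sin θ`, `r R' = ρ cos θ`. With `θ 1 = π / 2` the
inner boundary condition holds, and the outer one becomes `cos (θ δ) = 0`
(`IsRadialPhase.isEigenvalue_iff`). The outer phase `Θ lam = θ δ` is nonnegative, continuous,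
strictly increasing and unbounded (`exists_outerPhase`), so the eigenvalues are exactly the
solutions of `Θ lam = π / 2 + (j - 1) π`, `j ≥ 1`.

The asymptotics come from comparing phases. The constant `π / 2` is a subsolution for `lam = n²` and
a supersolution for `lam = n² / δ²`, which traps the first eigenvalue between these values. For
fixed `lam ≥ 0` the phase gains at most `(1 + lam δ)(δ - 1)`, which is below `π` for `δ` near 1, so
every later eigenvalue eventually exceeds `lam`. -/

/-! ### Calculus on a closed interval -/

theorem ContinuousOn.exists_hasDerivWithinAt_Icc {a b : ℝ} (hab : a ≤ b) {h : ℝ → ℝ}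
    (hh : ContinuousOn h (Icc a b)) :
    ∃ H : ℝ → ℝ, ∀ r ∈ Icc a b, HasDerivWithinAt H (h r) (Icc a b) r := by
  have hc : Continuous (IccExtend hab ((Icc a b).domRestrict h)) :=
    (continuousOn_iff_continuous_domRestrict.1 hh).Icc_extend'
  refine ⟨fun r => ∫ x in a..r, IccExtend hab ((Icc a b).domRestrict h) x, fun r hr => ?_⟩
  have := (hc.integral_hasStrictDerivAt a r).hasDerivAt.hasDerivWithinAt (s := Icc a b)
  rwa [IccExtend_of_mem hab _ hr] at this

theorem monotoneOn_Icc_of_hasDerivWithinAt_nonneg {a b : ℝ} {g g' : ℝ → ℝ}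
    (hg : ∀ r ∈ Icc a b, HasDerivWithinAt g (g' r) (Icc a b) r) (h0 : ∀ r ∈ Icc a b, 0 ≤ g' r) :
    MonotoneOn g (Icc a b) :=
  monotoneOn_of_hasDerivWithinAt_nonneg (convex_Icc a b)
    (fun r hr => (hg r hr).continuousWithinAt)
    (fun r hr => (hg r (interior_subset hr)).mono interior_subset)
    (fun r hr => h0 r (interior_subset hr))

theorem eq_of_hasDerivWithinAt_zero_Icc {a b : ℝ} {g : ℝ → ℝ}
    (hg : ∀ r ∈ Icc a b, HasDerivWithinAt g 0 (Icc a b) r) {x : ℝ} (hx : x ∈ Icc a b) :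
    g x = g a :=
  constant_of_derivWithin_zero (fun r hr => (hg r hr).differentiableWithinAt)
    (fun r hr => (hg r (Ico_subset_Icc_self hr)).derivWithin
      (uniqueDiffOn_Icc (hr.1.trans_lt hr.2) r (Ico_subset_Icc_self hr))) x hx

/-- A solution of `g' = h g + k` with `k ≥ 0` and `g a ≥ 0` stays nonnegative. -/
theorem nonneg_of_linear_ode {a b : ℝ} (hab : a < b) {g h k : ℝ → ℝ}
    (hh : ContinuousOn h (Icc a b)) (hk : ∀ r ∈ Icc a b, 0 ≤ k r) (ha : 0 ≤ g a)
    (hg : ∀ r ∈ Icc a b, HasDerivWithinAt g (h r * g r + k r) (Icc a b) r) :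
    0 ≤ g b ∧ (0 < k a → 0 < g b) := by
  obtain ⟨H, hH⟩ := hh.exists_hasDerivWithinAt_Icc hab.le
  have hG : ∀ r ∈ Icc a b, HasDerivWithinAt (fun r => g r * Real.exp (-H r))
      (k r * Real.exp (-H r)) (Icc a b) r := fun r hr => by
    refine ((hg r hr).mul (hH r hr).fun_neg.exp).congr_deriv ?_
    ring
  have hmono := monotoneOn_Icc_of_hasDerivWithinAt_nonneg hG
    (fun r hr => mul_nonneg (hk r hr) (Real.exp_pos _).le)
  have hma : a ∈ Icc a b := ⟨le_rfl, hab.le⟩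
  have hmb : b ∈ Icc a b := ⟨hab.le, le_rfl⟩
  have hGa : 0 ≤ g a * Real.exp (-H a) := mul_nonneg ha (Real.exp_pos _).le
  have hgb : 0 ≤ g b :=
    nonneg_of_mul_nonneg_left (hGa.trans (hmono hma hmb hab.le)) (Real.exp_pos _)
  -- If `g b = 0`, the monotone function `g exp (-H)` vanishes identically, so its derivative at `a`
  -- cannot be positive.
  refine ⟨hgb, fun hka => hgb.lt_of_ne fun h0 => ?_⟩
  have hzero : ∀ r ∈ Icc a b, g r * Real.exp (-H r) = 0 := fun r hr => by
    refine le_antisymm ?_ (hGa.trans (hmono hma hr hr.1))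
    simpa [← h0] using hmono hr hmb hr.2
  have h1 := (hasDerivWithinAt_const a (Icc a b) (0 : ℝ)).congr hzero (hzero a hma)
  have h2 := (uniqueDiffOn_Icc hab a hma).eq_deriv _ (hG a hma) h1
  exact (mul_pos hka (Real.exp_pos _)).ne' h2

/-! ### The Prüfer phase equation -/

theorem Real.sin_sq_sub_sin_sq (x y : ℝ) :
    Real.sin x ^ 2 - Real.sin y ^ 2 = Real.sin (x + y) * Real.sin (x - y) := by
  rw [Real.sin_add, Real.sin_sub]
  nlinarith [Real.sin_sq_add_cos_sq x, Real.sin_sq_add_cos_sq y]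

theorem Real.sinc_mul_self (x : ℝ) : Real.sinc x * x = Real.sin x := by
  rcases eq_or_ne x 0 with rfl | hx
  · simp
  · rw [Real.sinc_of_ne_zero hx, div_mul_cancel₀ _ hx]

/-- The right-hand side of the Prüfer equation for the phase of a solution of
`(u' / P)' + Q u = 0`. -/
noncomputable def pruferField (P Q : ℝ → ℝ) (r θ : ℝ) : ℝ :=
  P r * Real.cos θ ^ 2 + Q r * Real.sin θ ^ 2

theorem pruferField_sub (P Q : ℝ → ℝ) (r x y : ℝ) :
    pruferField P Q r x - pruferField P Q r y =
      (Q r - P r) * (Real.sin (x + y) * Real.sin (x - y)) := by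
  rw [← Real.sin_sq_sub_sin_sq, pruferField, pruferField, Real.cos_sq', Real.cos_sq']
  ring

theorem abs_pruferField_sub_le (P Q : ℝ → ℝ) (r x y : ℝ) :
    |pruferField P Q r x - pruferField P Q r y| ≤ |Q r - P r| * |x - y| := by
  rw [pruferField_sub, abs_mul, abs_mul]
  gcongr
  calc |Real.sin (x + y)| * |Real.sin (x - y)| ≤ 1 * |x - y| := by
        exact mul_le_mul (Real.abs_sin_le_one _) Real.abs_sin_le_abs (abs_nonneg _) zero_le_one
    _ = |x - y| := one_mul _

theorem abs_pruferField_le (P Q : ℝ → ℝ) (r x : ℝ) :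
    |pruferField P Q r x| ≤ |P r| + |Q r| := by
  have hs := Real.sin_sq_add_cos_sq x
  calc |pruferField P Q r x| ≤ |P r| * Real.cos x ^ 2 + |Q r| * Real.sin x ^ 2 := by
        refine (abs_add_le _ _).trans_eq ?_
        rw [abs_mul, abs_mul, abs_of_nonneg (sq_nonneg (Real.cos x)),
          abs_of_nonneg (sq_nonneg (Real.sin x))]
    _ ≤ |P r| * 1 + |Q r| * 1 := by
        gcongr
        · exact Real.cos_sq_le_one x
        · exact Real.sin_sq_le_one x
    _ = |P r| + |Q r| := by ring

/-- Comparison of a subsolution and a supersolution of the Prüfer equation. -/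
theorem pruferField_comparison {a b : ℝ} (hab : a < b) {P Q φ θ d e : ℝ → ℝ}
    (hP : ContinuousOn P (Icc a b)) (hQ : ContinuousOn Q (Icc a b))
    (hφ : ∀ r ∈ Icc a b, HasDerivWithinAt φ (pruferField P Q r (φ r) + d r) (Icc a b) r)
    (hθ : ∀ r ∈ Icc a b, HasDerivWithinAt θ (pruferField P Q r (θ r) + e r) (Icc a b) r)
    (hde : ∀ r ∈ Icc a b, d r ≤ e r) (ha : φ a ≤ θ a) :
    φ b ≤ θ b ∧ (d a < e a → φ b < θ b) := by
  have hcφ : ContinuousOn φ (Icc a b) := fun r hr => (hφ r hr).continuousWithinAt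
  have hcθ : ContinuousOn θ (Icc a b) := fun r hr => (hθ r hr).continuousWithinAt
  -- The difference solves a linear equation; `sinc` keeps its coefficient continuous where the two
  -- phases meet.
  have key := nonneg_of_linear_ode hab (g := fun r => θ r - φ r)
    (h := fun r => (Q r - P r) * (Real.sin (θ r + φ r) * Real.sinc (θ r - φ r)))
    (k := fun r => e r - d r)
    ((hQ.sub hP).mul ((Real.continuous_sin.comp_continuousOn (hcθ.add hcφ)).mul
      (Real.continuous_sinc.comp_continuousOn (hcθ.sub hcφ))))
    (fun r hr => sub_nonneg.2 (hde r hr)) (sub_nonneg.2 ha) (fun r hr => by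
      refine ((hθ r hr).sub (hφ r hr)).congr_deriv ?_
      have := pruferField_sub P Q r (θ r) (φ r)
      rw [← Real.sinc_mul_self (θ r - φ r)] at this
      linear_combination this)
  simpa only [sub_nonneg, sub_pos] using key

theorem exists_prufer_solution {a b : ℝ} (hab : a < b) {P Q : ℝ → ℝ}
    (hP : ContinuousOn P (Icc a b)) (hQ : ContinuousOn Q (Icc a b)) (θ₀ : ℝ) :
    ∃ θ : ℝ → ℝ, θ a = θ₀ ∧
      ∀ r ∈ Icc a b, HasDerivWithinAt θ (pruferField P Q r (θ r)) (Icc a b) r := by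
  obtain ⟨A, hA⟩ := isCompact_Icc.exists_bound_of_continuousOn hP
  obtain ⟨B, hB⟩ := isCompact_Icc.exists_bound_of_continuousOn hQ
  have hma : a ∈ Icc a b := ⟨le_rfl, hab.le⟩
  have hA0 : 0 ≤ A := (norm_nonneg _).trans (hA a hma)
  have hB0 : 0 ≤ B := (norm_nonneg _).trans (hB a hma)
  -- The field is bounded by `A + B` for all phases, so a ball of radius `(A + B) * (b - a)` holds
  -- the solution on the whole interval.
  have hpl : IsPicardLindelof (pruferField P Q) (⟨a, hma⟩ : Icc a b) θ₀
      (Real.toNNReal ((A + B) * (b - a))) 0 (Real.toNNReal (A + B)) (Real.toNNReal (A + B)) := by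
    refine ⟨fun r hr => LipschitzOnWith.of_dist_le_mul fun x _ y _ => ?_, fun x _ => ?_,
      fun r hr x _ => ?_, ?_⟩
    · rw [Real.dist_eq, Real.dist_eq, Real.coe_toNNReal _ (by positivity)]
      refine (abs_pruferField_sub_le P Q r x y).trans ?_
      gcongr
      have h1 := hA r hr
      have h2 := hB r hr
      have h3 := norm_sub_le (Q r) (P r)
      rw [← Real.norm_eq_abs]
      linarith
    · unfold pruferField
      fun_prop
    · rw [Real.coe_toNNReal _ (by positivity)]
      exact (abs_pruferField_le P Q r x).trans (add_le_add (hA r hr) (hB r hr))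
    · have : 0 ≤ b - a := sub_nonneg.2 hab.le
      rw [Real.coe_toNNReal _ (by positivity), Real.coe_toNNReal _ (by positivity)]
      simp [this]
  exact hpl.exists_eq_forall_mem_Icc_hasDerivWithinAt₀

/-! ### Eigenvalues in terms of the radial phase -/

/-- The coefficient of `R` in the self-adjoint form `(r R')' + (lam r - n² / r) R = 0` of the
radial equation. -/
noncomputable def radialPotential (n : ℕ) (lam r : ℝ) : ℝ := lam * r - (n : ℝ) ^ 2 * r⁻¹

theorem continuousOn_inv_Icc_one (δ : ℝ) : ContinuousOn (fun r : ℝ => r⁻¹) (Icc 1 δ) :=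
  continuousOn_inv₀.mono fun _ hr => (zero_lt_one.trans_le hr.1).ne'

theorem continuousOn_radialPotential (n : ℕ) (lam δ : ℝ) :
    ContinuousOn (radialPotential n lam) (Icc 1 δ) :=
  (continuousOn_const.mul continuousOn_id).sub
    (continuousOn_const.mul (continuousOn_inv_Icc_one δ))

/-- The Prüfer phase, with value `π / 2` at `1`, of the solution of the radial equation with
`R' 1 = 0`. -/
def IsRadialPhase (n : ℕ) (δ lam : ℝ) (θ : ℝ → ℝ) : Prop :=
  θ 1 = Real.pi / 2 ∧ ∀ r ∈ Icc 1 δ, HasDerivWithinAt θ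
    (pruferField (fun r => r⁻¹) (radialPotential n lam) r (θ r)) (Icc 1 δ) r

theorem exists_isRadialPhase (n : ℕ) {δ : ℝ} (hδ : 1 < δ) (lam : ℝ) :
    ∃ θ, IsRadialPhase n δ lam θ :=
  exists_prufer_solution hδ (continuousOn_inv_Icc_one δ) (continuousOn_radialPotential n lam δ) _

namespace IsRadialPhase

variable {n : ℕ} {δ lam : ℝ} {θ : ℝ → ℝ}

theorem continuousOn (h : IsRadialPhase n δ lam θ) : ContinuousOn θ (Icc 1 δ) :=
  fun r hr => (h.2 r hr).continuousWithinAt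

theorem hasDerivWithinAt (h : IsRadialPhase n δ lam θ) {r : ℝ} (hr : r ∈ Icc 1 δ) :
    HasDerivWithinAt θ
      (r⁻¹ * Real.cos (θ r) ^ 2 + radialPotential n lam r * Real.sin (θ r) ^ 2) (Icc 1 δ) r :=
  h.2 r hr

/-- The Prüfer amplitude. -/
theorem exists_amplitude (h : IsRadialPhase n δ lam θ) (hδ : 1 < δ) :
    ∃ ρ : ℝ → ℝ, (∀ r, 0 < ρ r) ∧ ∀ r ∈ Icc 1 δ, HasDerivWithinAt ρ
      ((r⁻¹ - radialPotential n lam r) * Real.sin (θ r) * Real.cos (θ r) * ρ r) (Icc 1 δ) r := by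
  have hc : ContinuousOn (fun r => (r⁻¹ - radialPotential n lam r) * Real.sin (θ r)
      * Real.cos (θ r)) (Icc 1 δ) :=
    (((continuousOn_inv_Icc_one δ).sub (continuousOn_radialPotential n lam δ)).mul
      (Real.continuous_sin.comp_continuousOn h.continuousOn)).mul
      (Real.continuous_cos.comp_continuousOn h.continuousOn)
  obtain ⟨H, hH⟩ := hc.exists_hasDerivWithinAt_Icc hδ.le
  refine ⟨fun r => Real.exp (H r), fun r => Real.exp_pos _, fun r hr => ?_⟩
  refine ((hH r hr).exp).congr_deriv ?_
  ring

theorem isEigenvalue_of_cos_eq_zero (h : IsRadialPhase n δ lam θ) (hδ : 1 < δ)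
    (hcos : Real.cos (θ δ) = 0) : IsRadialNeumannEigenvalue n δ lam := by
  obtain ⟨ρ, hρ, hρ'⟩ := h.exists_amplitude hδ
  have hcv : ∀ r ∈ Icc 1 δ, HasDerivWithinAt (fun r => ρ r * Real.cos (θ r))
      (-(radialPotential n lam r * (ρ r * Real.sin (θ r)))) (Icc 1 δ) r := fun r hr => by
    refine ((hρ' r hr).mul (h.hasDerivWithinAt hr).cos).congr_deriv ?_
    linear_combination (-(radialPotential n lam r * ρ r * Real.sin (θ r))) *
      (Real.sin_sq_add_cos_sq (θ r))
  refine ⟨fun r => ρ r * Real.sin (θ r), fun r => r⁻¹ * (ρ r * Real.cos (θ r)),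
    fun r => -(r ^ 2)⁻¹ * (ρ r * Real.cos (θ r))
      + r⁻¹ * -(radialPotential n lam r * (ρ r * Real.sin (θ r))), fun r hr => ?_, fun r hr => ?_,
    ⟨1, ⟨le_rfl, hδ.le⟩, ?_⟩, fun r hr => ?_, ?_, ?_⟩
  · refine ((hρ' r hr).mul (h.hasDerivWithinAt hr).sin).congr_deriv ?_
    linear_combination (r⁻¹ * ρ r * Real.cos (θ r)) * (Real.sin_sq_add_cos_sq (θ r))
  · have hr0 : r ≠ 0 := (zero_lt_one.trans_le hr.1).ne'
    exact (hasDerivAt_inv hr0).hasDerivWithinAt.mul (hcv r hr)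
  · simp [h.1, (hρ 1).ne']
  · have hr0 : r ≠ 0 := (zero_lt_one.trans_le hr.1).ne'
    simp only [radialPotential]
    field_simp
    ring
  · simp [h.1]
  · simp [hcos]

/-- The Wronskian of `R` with the Prüfer solution vanishes, so `(R, r R')` is a constant multiple of
`ρ (sin θ, cos θ)`; the constant is nonzero because `R` is. -/
theorem cos_eq_zero_of_isEigenvalue (h : IsRadialPhase n δ lam θ) (hδ : 1 < δ)
    (hev : IsRadialNeumannEigenvalue n δ lam) : Real.cos (θ δ) = 0 := by
  obtain ⟨ρ, hρ, hρ'⟩ := h.exists_amplitude hδ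
  obtain ⟨R, R', R'', hR, hR', ⟨x, hx, hRx⟩, hode, h1, h2⟩ := hev
  have hmδ : δ ∈ Icc 1 δ := ⟨hδ.le, le_rfl⟩
  have hV : ∀ r ∈ Icc 1 δ, HasDerivWithinAt (fun r => r * R' r)
      (-(radialPotential n lam r * R r)) (Icc 1 δ) r := fun r hr => by
    refine ((hasDerivWithinAt_id r (Icc 1 δ)).mul (hR' r hr)).congr_deriv ?_
    have hr0 : r ≠ 0 := (zero_lt_one.trans_le hr.1).ne'
    have := hode r hr
    simp only [radialPotential, id]
    field_simp at this ⊢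
    linear_combination this
  have hwr : ∀ r ∈ Icc 1 δ,
      (R r * Real.cos (θ r) - r * R' r * Real.sin (θ r)) * ρ r = 0 := fun r hr => by
    rw [eq_of_hasDerivWithinAt_zero_Icc (g := fun r =>
      (R r * Real.cos (θ r) - r * R' r * Real.sin (θ r)) * ρ r) (fun s hs => ?_) hr]
    · simp [h.1, h1]
    · refine ((((hR s hs).mul (h.hasDerivWithinAt hs).cos).sub
        ((hV s hs).mul (h.hasDerivWithinAt hs).sin)).mul (hρ' s hs)).congr_deriv ?_
      have hs0 : s ≠ 0 := (zero_lt_one.trans_le hs.1).ne'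
      have hcs := Real.sin_sq_add_cos_sq (θ s)
      simp only [Pi.sub_apply, Pi.mul_apply]
      field_simp
      rw [Real.cos_sq']
      linear_combination (ρ s * R s * Real.sin (θ s) * (1 - s * radialPotential n lam s)) * hcs
  have hw : ∀ r ∈ Icc 1 δ, R r * Real.cos (θ r) = r * R' r * Real.sin (θ r) := fun r hr =>
    sub_eq_zero.1 ((mul_eq_zero.1 (hwr r hr)).resolve_right (hρ r).ne')
  have hm : ∀ r ∈ Icc 1 δ, (R r * Real.sin (θ r) + r * R' r * Real.cos (θ r)) / ρ r =
      (R 1 * Real.sin (θ 1) + 1 * R' 1 * Real.cos (θ 1)) / ρ 1 := fun r hr => by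
    refine eq_of_hasDerivWithinAt_zero_Icc (g := fun r =>
      (R r * Real.sin (θ r) + r * R' r * Real.cos (θ r)) / ρ r) (fun s hs => ?_) hr
    refine ((((hR s hs).mul (h.hasDerivWithinAt hs).sin).add
      ((hV s hs).mul (h.hasDerivWithinAt hs).cos)).div (hρ' s hs) (hρ s).ne').congr_deriv ?_
    have hs0 : s ≠ 0 := (zero_lt_one.trans_le hs.1).ne'
    have hcs := Real.sin_sq_add_cos_sq (θ s)
    have hws := hw s hs
    simp only [Pi.add_apply, Pi.mul_apply]
    field_simp
    rw [mul_zero, div_eq_zero_iff]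
    left
    linear_combination (Real.cos (θ s) ^ 2 + Real.sin (θ s) ^ 2 * s * radialPotential n lam s
      - s * radialPotential n lam s - Real.sin (θ s) ^ 2 * (1 - s * radialPotential n lam s)) * hws
      - s * R' s * Real.sin (θ s) * (1 - s * radialPotential n lam s) * hcs
  simp only [h.1, h1, Real.sin_pi_div_two, mul_one, mul_zero, zero_mul, add_zero] at hm
  have hmR : ∀ r ∈ Icc 1 δ, R r * Real.sin (θ r) + r * R' r * Real.cos (θ r) = R 1 / ρ 1 * ρ r :=
    fun r hr => by rw [← hm r hr, div_mul_cancel₀ _ (hρ r).ne']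
  have hR1 : R 1 ≠ 0 := fun h0 => hRx <| by
    have e1 := hmR x hx
    have e2 := hw x hx
    rw [h0, zero_div, zero_mul] at e1
    linear_combination Real.sin (θ x) * e1 + Real.cos (θ x) * e2
      - R x * Real.sin_sq_add_cos_sq (θ x)
  have e1 := hmR δ hmδ
  have e2 := hw δ hmδ
  rw [h2, mul_zero, zero_mul] at e1 e2
  rcases mul_eq_zero.1 e2 with h0 | h0
  · rw [h0, zero_mul, zero_add] at e1
    exact absurd e1.symm (mul_ne_zero (div_ne_zero hR1 (hρ 1).ne') (hρ δ).ne')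
  · exact h0

theorem isEigenvalue_iff (h : IsRadialPhase n δ lam θ) (hδ : 1 < δ) :
    IsRadialNeumannEigenvalue n δ lam ↔ Real.cos (θ δ) = 0 :=
  ⟨h.cos_eq_zero_of_isEigenvalue hδ, h.isEigenvalue_of_cos_eq_zero hδ⟩

/-! ### Monotonicity and bounds for the outer phase -/

theorem lt_of_lt {mu : ℝ} {ψ : ℝ → ℝ} (h : IsRadialPhase n δ lam θ)
    (hψ : IsRadialPhase n δ mu ψ) (hδ : 1 < δ) (hlt : lam < mu) : θ δ < ψ δ := by
  refine (pruferField_comparison hδ (continuousOn_inv_Icc_one δ)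
    (continuousOn_radialPotential n lam δ) (d := fun _ => 0)
    (e := fun r => (mu - lam) * r * Real.sin (ψ r) ^ 2)
    (fun r hr => by simpa using h.2 r hr) (fun r hr => ?_) (fun r hr => ?_)
    (by rw [h.1, hψ.1])).2 ?_
  · refine (hψ.2 r hr).congr_deriv ?_
    simp only [pruferField, radialPotential]
    ring
  · have := sub_pos.2 hlt
    have := zero_lt_one.trans_le hr.1
    positivity
  -- Strictness is needed only at `r = 1`, where `sin (π / 2) = 1`.
  · simpa [hψ.1] using hlt

theorem nonneg (h : IsRadialPhase n δ lam θ) (hδ : 1 < δ) : 0 ≤ θ δ := by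
  refine (pruferField_comparison hδ (continuousOn_inv_Icc_one δ)
    (continuousOn_radialPotential n lam δ) (φ := fun _ => 0) (d := fun r => -r⁻¹)
    (e := fun _ => 0) (fun r hr => ?_)
    (fun r hr => by simpa using h.2 r hr) (fun r hr => ?_) ?_).1
  · refine (hasDerivWithinAt_const r (Icc 1 δ) (0 : ℝ)).congr_deriv ?_
    simp [pruferField]
  · have := zero_lt_one.trans_le hr.1
    simp [this.le]
  · rw [h.1]
    positivity

theorem pi_div_two_le (h : IsRadialPhase n δ ((n : ℝ) ^ 2) θ) (hδ : 1 < δ) :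
    Real.pi / 2 ≤ θ δ := by
  refine (pruferField_comparison hδ (continuousOn_inv_Icc_one δ)
    (continuousOn_radialPotential n _ δ) (φ := fun _ => Real.pi / 2)
    (d := fun r => -radialPotential n ((n : ℝ) ^ 2) r)
    (e := fun _ => 0) (fun r hr => ?_)
    (fun r hr => by simpa using h.2 r hr) (fun r hr => ?_) h.1.ge).1
  · refine (hasDerivWithinAt_const r (Icc 1 δ) (Real.pi / 2)).congr_deriv ?_
    simp [pruferField]
  · have : r⁻¹ ≤ r := (inv_le_one_of_one_le₀ hr.1).trans hr.1
    simp only [radialPotential, ← mul_sub, neg_nonpos]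
    exact mul_nonneg (sq_nonneg _) (sub_nonneg.2 this)

theorem le_pi_div_two (h : IsRadialPhase n δ ((n : ℝ) ^ 2 / δ ^ 2) θ) (hδ : 1 < δ) :
    θ δ ≤ Real.pi / 2 ∧ (1 ≤ n → θ δ < Real.pi / 2) := by
  have hδ0 : 0 < δ := zero_lt_one.trans hδ
  have hcomp := pruferField_comparison hδ (continuousOn_inv_Icc_one δ)
    (continuousOn_radialPotential n ((n : ℝ) ^ 2 / δ ^ 2) δ) (θ := fun _ => Real.pi / 2)
    (e := fun r => -radialPotential n ((n : ℝ) ^ 2 / δ ^ 2) r)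
    (d := fun _ => 0) (fun r hr => by simpa using h.2 r hr) (fun r hr => ?_)
    (fun r hr => ?_) h.1.le
  · refine ⟨hcomp.1, fun hn => hcomp.2 ?_⟩
    have hn0 : (0 : ℝ) < n := by exact_mod_cast hn
    have : (n : ℝ) ^ 2 / δ ^ 2 < (n : ℝ) ^ 2 :=
      div_lt_self (by positivity) (one_lt_pow₀ hδ two_ne_zero)
    simpa [radialPotential] using this
  · refine (hasDerivWithinAt_const r (Icc 1 δ) (Real.pi / 2)).congr_deriv ?_
    simp [pruferField]
  · have hr0 := zero_lt_one.trans_le hr.1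
    have hle : r ^ 2 ≤ δ ^ 2 := pow_le_pow_left₀ hr0.le hr.2 2
    have e : -radialPotential n ((n : ℝ) ^ 2 / δ ^ 2) r
        = (n : ℝ) ^ 2 * (δ ^ 2 - r ^ 2) / (δ ^ 2 * r) := by
      rw [radialPotential]
      field_simp
      ring
    rw [e]
    have := sub_nonneg.2 hle
    positivity

theorem le_of_nonneg (h : IsRadialPhase n δ lam θ) (hδ : 1 < δ) (hlam : 0 ≤ lam) :
    θ δ ≤ Real.pi / 2 + (1 + lam * δ) * (δ - 1) := by
  have hd : ∀ r ∈ Icc 1 δ, HasDerivWithinAt (fun r => (1 + lam * δ) * r - θ r)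
      ((1 + lam * δ) - (r⁻¹ * Real.cos (θ r) ^ 2 + radialPotential n lam r * Real.sin (θ r) ^ 2))
      (Icc 1 δ) r := fun r hr => by
    refine (((hasDerivWithinAt_id r (Icc 1 δ)).const_mul (1 + lam * δ)).fun_sub
      (h.hasDerivWithinAt hr)).congr_deriv ?_
    rw [mul_one]
  have := monotoneOn_Icc_of_hasDerivWithinAt_nonneg hd (fun r hr => ?_)
    ⟨le_rfl, hδ.le⟩ ⟨hδ.le, le_rfl⟩ hδ.le
  · simp only [h.1] at this
    linarith
  · have hr0 := zero_lt_one.trans_le hr.1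
    have h1 : r⁻¹ * Real.cos (θ r) ^ 2 ≤ 1 * 1 :=
      mul_le_mul (inv_le_one_of_one_le₀ hr.1) (Real.cos_sq_le_one _) (sq_nonneg _) zero_le_one
    have h2 : radialPotential n lam r ≤ lam * δ := by
      have : 0 ≤ (n : ℝ) ^ 2 * r⁻¹ := by positivity
      have := mul_le_mul_of_nonneg_left hr.2 hlam
      rw [radialPotential]
      linarith
    have h3 : radialPotential n lam r * Real.sin (θ r) ^ 2 ≤ lam * δ * 1 :=
      mul_le_mul h2 (Real.sin_sq_le_one _) (sq_nonneg _) (by positivity)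
    linarith

end IsRadialPhase

/-! ### Growth of the phase for large parameter -/

theorem cos_sq_add_mul_sin_sq_pos {c : ℝ} (hc : 0 < c) (x : ℝ) :
    0 < Real.cos x ^ 2 + c * Real.sin x ^ 2 := by
  have h := Real.sin_sq_add_cos_sq x
  rcases eq_or_ne (Real.sin x) 0 with h0 | h0
  · have : Real.cos x ^ 2 = 1 := by simpa [h0] using h
    rw [this, h0]
    norm_num
  · positivity

/-- The phase rescaled so that it rotates uniformly for constant coefficients. -/
noncomputable def rescaledPhase (M x : ℝ) : ℝ :=
  x + Real.arctan ((M - 1) * (Real.sin x * Real.cos x) / (Real.cos x ^ 2 + M * Real.sin x ^ 2))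

/-- The rescaled phase is a branch-free form of `arctan (M tan x)`, within `π / 2` of `x`. -/
theorem hasDerivAt_rescaledPhase {M : ℝ} (hM : 0 < M) (x : ℝ) :
    HasDerivAt (rescaledPhase M) (M / (Real.cos x ^ 2 + M ^ 2 * Real.sin x ^ 2)) x := by
  have hD := (cos_sq_add_mul_sin_sq_pos hM x).ne'
  have hD2 := (cos_sq_add_mul_sin_sq_pos (pow_pos hM 2) x).ne'
  have h := Real.sin_sq_add_cos_sq x
  have hN := (((Real.hasDerivAt_sin x).mul (Real.hasDerivAt_cos x)).const_mul (M - 1)).div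
    (((Real.hasDerivAt_cos x).fun_pow 2).add (((Real.hasDerivAt_sin x).fun_pow 2).const_mul M)) hD
  refine ((hasDerivAt_id x).add hN.arctan).congr_deriv ?_
  have key : 1 + ((M - 1) * (Real.sin x * Real.cos x) /
      (Real.cos x ^ 2 + M * Real.sin x ^ 2)) ^ 2 =
      (Real.cos x ^ 2 + M ^ 2 * Real.sin x ^ 2) /
        (Real.cos x ^ 2 + M * Real.sin x ^ 2) ^ 2 := by
    rw [eq_div_iff (pow_ne_zero 2 hD), div_pow, add_mul, div_mul_cancel₀ _ (pow_ne_zero 2 hD)]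
    linear_combination (Real.cos x ^ 2 + M ^ 2 * Real.sin x ^ 2) * h
  simp only [Pi.add_apply, Pi.mul_apply, Pi.div_apply]
  rw [key]
  field_simp
  linear_combination (Real.cos x ^ 2 - M * Real.sin x ^ 2) * (M - 1) * h + M * h

namespace IsRadialPhase

variable {n : ℕ} {δ lam : ℝ} {θ : ℝ → ℝ}

/-- The field is at least `δ⁻¹ (cos² θ + M² sin² θ)`, so the rescaled phase grows at rate at least
`M δ⁻¹`. The initial `π / 2` pays for undoing the rescaling. -/
theorem le_of_large (h : IsRadialPhase n δ lam θ) (hδ : 1 < δ) {M : ℝ} (hM : 0 < M)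
    (hlam : (n : ℝ) ^ 2 + M ^ 2 ≤ lam) : M * (1 - δ⁻¹) ≤ θ δ := by
  have hδ0 : 0 < δ := zero_lt_one.trans hδ
  have hd : ∀ r ∈ Icc 1 δ, HasDerivWithinAt (fun r => rescaledPhase M (θ r) - M * δ⁻¹ * r)
      (M / (Real.cos (θ r) ^ 2 + M ^ 2 * Real.sin (θ r) ^ 2) *
        (r⁻¹ * Real.cos (θ r) ^ 2 + radialPotential n lam r * Real.sin (θ r) ^ 2) - M * δ⁻¹)
      (Icc 1 δ) r := fun r hr => by
    refine (((hasDerivAt_rescaledPhase hM (θ r)).comp_hasDerivWithinAt r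
      (h.hasDerivWithinAt hr)).sub
      ((hasDerivWithinAt_id r (Icc 1 δ)).const_mul (M * δ⁻¹))).congr_deriv ?_
    rw [mul_one]
  have := monotoneOn_Icc_of_hasDerivWithinAt_nonneg hd (fun r hr => ?_)
    ⟨le_rfl, hδ.le⟩ ⟨hδ.le, le_rfl⟩ hδ.le
  · simp only [h.1] at this
    have h1 : rescaledPhase M (Real.pi / 2) = Real.pi / 2 := by simp [rescaledPhase]
    have h2 : rescaledPhase M (θ δ) ≤ θ δ + Real.pi / 2 :=
      add_le_add_right (Real.arctan_lt_pi_div_two _).le _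
    rw [h1, mul_assoc M δ⁻¹ δ, inv_mul_cancel₀ hδ0.ne'] at this
    linarith
  · have hr0 := zero_lt_one.trans_le hr.1
    have hD := cos_sq_add_mul_sin_sq_pos (pow_pos hM 2) (θ r)
    have hP : δ⁻¹ ≤ r⁻¹ := inv_anti₀ hr0 hr.2
    have hδ1 : δ⁻¹ ≤ 1 := inv_le_one_of_one_le₀ hδ.le
    have hQ : δ⁻¹ * M ^ 2 ≤ radialPotential n lam r := by
      have e1 : δ⁻¹ * M ^ 2 ≤ 1 * M ^ 2 := mul_le_mul_of_nonneg_right hδ1 (sq_nonneg _)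
      have e2 : (n : ℝ) ^ 2 * r⁻¹ ≤ (n : ℝ) ^ 2 * 1 :=
        mul_le_mul_of_nonneg_left (inv_le_one_of_one_le₀ hr.1) (sq_nonneg _)
      have e3 : lam * 1 ≤ lam * r :=
        mul_le_mul_of_nonneg_left hr.1 (le_trans (by positivity) hlam)
      rw [radialPotential]
      linarith
    rw [sub_nonneg, div_mul_eq_mul_div, le_div_iff₀ hD, mul_assoc]
    refine mul_le_mul_of_nonneg_left ?_ hM.le
    have e1 := mul_le_mul_of_nonneg_right hP (sq_nonneg (Real.cos (θ r)))
    have e2 := mul_le_mul_of_nonneg_right hQ (sq_nonneg (Real.sin (θ r)))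
    linarith

end IsRadialPhase

/-! ### Dependence on the spectral parameter -/

theorem exists_radialPhase_lipschitz (n : ℕ) {δ : ℝ} (hδ : 1 < δ) (lam : ℝ) :
    ∃ C : ℝ, ∀ (mu : ℝ) (θ ψ : ℝ → ℝ), IsRadialPhase n δ lam θ → IsRadialPhase n δ mu ψ →
      |ψ δ - θ δ| ≤ C * |mu - lam| := by
  obtain ⟨A, hA⟩ := isCompact_Icc.exists_bound_of_continuousOn
    ((continuousOn_radialPotential n lam δ).sub (continuousOn_inv_Icc_one δ))
  have hA0 : 0 ≤ A := (norm_nonneg _).trans (hA 1 ⟨le_rfl, hδ.le⟩)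
  -- Enlarging `A` to `A + 1` selects the nondegenerate Grönwall formula.
  have hK : A + 1 ≠ 0 := by positivity
  refine ⟨δ / (A + 1) * (Real.exp ((A + 1) * (δ - 1)) - 1), fun mu θ ψ hθ hψ => ?_⟩
  have hd : ∀ r ∈ Icc 1 δ, HasDerivWithinAt (fun r => ψ r - θ r) _ (Icc 1 δ) r := fun r hr =>
    (hψ.2 r hr).fun_sub (hθ.2 r hr)
  have key := norm_le_gronwallBound_of_norm_deriv_right_le (δ := 0) (K := A + 1)
    (ε := |mu - lam| * δ) (hψ.continuousOn.fun_sub hθ.continuousOn)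
    (fun r hr => (hd r (Ico_subset_Icc_self hr)).mono_of_mem_nhdsWithin
      (Icc_mem_nhdsGE_of_mem hr)) (by simp [hθ.1, hψ.1]) (fun r hr => ?_) δ ⟨hδ.le, le_rfl⟩
  · rw [gronwallBound_of_K_ne_0 hK, Real.norm_eq_abs] at key
    refine key.trans_eq ?_
    ring
  · have hr0 := zero_lt_one.trans_le hr.1
    have e : pruferField (fun r => r⁻¹) (radialPotential n mu) r (ψ r)
        = pruferField (fun r => r⁻¹) (radialPotential n lam) r (ψ r)
          + (mu - lam) * (r * Real.sin (ψ r) ^ 2) := by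
      simp only [pruferField, radialPotential]
      ring
    rw [e, add_sub_right_comm]
    refine (norm_add_le _ _).trans (add_le_add ?_ ?_)
    · refine (abs_pruferField_sub_le _ _ r (ψ r) (θ r)).trans
        (mul_le_mul_of_nonneg_right ?_ (abs_nonneg _))
      exact (hA r (Ico_subset_Icc_self hr)).trans (by linarith)
    · rw [norm_mul, Real.norm_eq_abs, Real.norm_eq_abs,
        abs_of_nonneg (a := r * Real.sin (ψ r) ^ 2) (by positivity)]
      refine mul_le_mul_of_nonneg_left ?_ (abs_nonneg _)
      calc r * Real.sin (ψ r) ^ 2 ≤ δ * 1 :=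
            mul_le_mul hr.2.le (Real.sin_sq_le_one _) (sq_nonneg _) (hr0.le.trans hr.2.le)
        _ = δ := mul_one δ

/-- The phase at the outer radius as a function of the spectral parameter. -/
theorem exists_outerPhase (n : ℕ) {δ : ℝ} (hδ : 1 < δ) :
    ∃ Θ : ℝ → ℝ, (∀ lam, ∃ θ, IsRadialPhase n δ lam θ ∧ θ δ = Θ lam) ∧
      StrictMono Θ ∧ Continuous Θ ∧ Tendsto Θ atTop atTop := by
  choose θ hθ using fun lam => exists_isRadialPhase n hδ lam
  refine ⟨fun lam => θ lam δ, fun lam => ⟨θ lam, hθ lam, rfl⟩,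
    fun lam mu h => (hθ lam).lt_of_lt (hθ mu) hδ h, continuous_iff_continuousAt.2 fun lam => ?_, ?_⟩
  · obtain ⟨C, hC⟩ := exists_radialPhase_lipschitz n hδ lam
    refine tendsto_iff_norm_sub_tendsto_zero.2 (squeeze_zero (fun _ => norm_nonneg _)
      (fun mu => hC mu _ _ (hθ lam) (hθ mu)) ?_)
    have : Continuous fun mu : ℝ => C * |mu - lam| := by fun_prop
    simpa using this.tendsto lam
  · have hpos : 0 < 1 - δ⁻¹ := sub_pos.2 (inv_lt_one_of_one_lt₀ hδ)
    refine tendsto_atTop.2 fun b => ?_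
    have hM : 0 < (|b| + 1) / (1 - δ⁻¹) := by positivity
    filter_upwards [eventually_ge_atTop ((n : ℝ) ^ 2 + ((|b| + 1) / (1 - δ⁻¹)) ^ 2)] with lam hlam
    have := (hθ lam).le_of_large hδ hM hlam
    rw [div_mul_cancel₀ _ hpos.ne'] at this
    linarith [le_abs_self b]

/-! ### Enumeration and asymptotics -/

/-- Enumeration of the eigenvalues by the phase at the outer radius. -/
theorem exists_eigenvalue_enumeration (n : ℕ) {δ : ℝ} (hδ : 1 < δ) :
    ∃ lam : ℕ+ → ℝ, Set.range lam = {μ : ℝ | IsRadialNeumannEigenvalue n δ μ} ∧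
      StrictMono lam ∧ Tendsto lam atTop atTop ∧
      (n : ℝ) ^ 2 / δ ^ 2 ≤ lam 1 ∧ (1 ≤ n → (n : ℝ) ^ 2 / δ ^ 2 < lam 1) ∧
      lam 1 ≤ (n : ℝ) ^ 2 ∧
      ∀ Λ : ℝ, 0 ≤ Λ → (1 + Λ * δ) * (δ - 1) < Real.pi → ∀ j : ℕ+, 1 < j → Λ < lam j := by
  obtain ⟨Θ, hΘ, hmono, hcont, htop⟩ := exists_outerPhase n hδ
  have hπ := Real.pi_pos
  have hlow : Θ ((n : ℝ) ^ 2 / δ ^ 2) ≤ Real.pi / 2 ∧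
      (1 ≤ n → Θ ((n : ℝ) ^ 2 / δ ^ 2) < Real.pi / 2) := by
    obtain ⟨θ, h, e⟩ := hΘ ((n : ℝ) ^ 2 / δ ^ 2)
    exact e ▸ h.le_pi_div_two hδ
  have hup : Real.pi / 2 ≤ Θ ((n : ℝ) ^ 2) := by
    obtain ⟨θ, h, e⟩ := hΘ ((n : ℝ) ^ 2)
    exact e ▸ h.pi_div_two_le hδ
  have hev : ∀ mu, IsRadialNeumannEigenvalue n δ mu ↔ Real.cos (Θ mu) = 0 := fun mu => by
    obtain ⟨θ, h, e⟩ := hΘ mu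
    exact e ▸ h.isEigenvalue_iff hδ
  have hnonneg : ∀ mu, 0 ≤ Θ mu := fun mu => by
    obtain ⟨θ, h, e⟩ := hΘ mu
    exact e ▸ h.nonneg hδ
  have hex : ∀ j : ℕ+, ∃ mu, Θ mu = Real.pi / 2 + ((j : ℕ) - 1 : ℝ) * Real.pi := fun j => by
    obtain ⟨b, hb, hbΘ⟩ := (htop.eventually_ge_atTop
      (Real.pi / 2 + ((j : ℕ) - 1 : ℝ) * Real.pi)).and
      (eventually_ge_atTop ((n : ℝ) ^ 2 / δ ^ 2)) |>.exists
    have hj : (1 : ℝ) ≤ (j : ℕ) := by exact_mod_cast j.pos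
    obtain ⟨mu, -, hmu⟩ := intermediate_value_Icc hbΘ hcont.continuousOn
      ⟨hlow.1.trans (le_add_of_nonneg_right (mul_nonneg (sub_nonneg.2 hj) hπ.le)), hb⟩
    exact ⟨mu, hmu⟩
  choose lam hlam using hex
  have hlam1 : Θ (lam 1) = Real.pi / 2 := by simpa using hlam 1
  refine ⟨lam, ?_, fun i j hij => ?_, ?_, ?_, fun hn => ?_, ?_, fun Λ hΛ hlt j hj => ?_⟩
  · ext mu
    rw [mem_ofPred_eq, hev, Real.cos_eq_zero_iff]
    constructor
    · rintro ⟨j, rfl⟩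
      refine ⟨(j : ℕ) - 1, ?_⟩
      rw [hlam]
      push_cast
      ring
    · rintro ⟨k, hk⟩
      -- A negative `k` would force a phase of at most `-π / 2`.
      have hk0 : 0 ≤ k := by
        by_contra hneg
        have : (k : ℝ) ≤ -1 := by exact_mod_cast (by lia : k ≤ -1)
        have := hnonneg mu
        rw [hk] at this
        nlinarith
      lift k to ℕ using hk0
      refine ⟨k.succPNat, hmono.injective ?_⟩
      rw [hlam, hk, Nat.succPNat_coe]
      push_cast
      ring
  · rw [← hmono.lt_iff_lt, hlam, hlam]
    have : ((i : ℕ) : ℝ) < (j : ℕ) := by exact_mod_cast hij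
    gcongr
  · refine tendsto_atTop.2 fun b => ?_
    obtain ⟨N, hN⟩ := exists_nat_ge (Θ b / Real.pi + 1)
    filter_upwards [eventually_ge_atTop N.succPNat] with j hj
    rw [← hmono.le_iff_le, hlam]
    have hj' : (N : ℝ) ≤ (j : ℕ) := by
      have : (N.succPNat : ℕ) ≤ j := hj
      exact_mod_cast (by simpa using this : N + 1 ≤ (j : ℕ)).trans' N.le_succ
    have : Θ b ≤ ((j : ℕ) - 1 : ℝ) * Real.pi := by
      rw [← div_le_iff₀ hπ]
      linarith
    linarith
  · rw [← hmono.le_iff_le, hlam1]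
    exact hlow.1
  · rw [← hmono.lt_iff_lt, hlam1]
    exact hlow.2 hn
  · rw [← hmono.le_iff_le, hlam1]
    exact hup
  · rw [← hmono.lt_iff_lt, hlam]
    obtain ⟨θ, h, e⟩ := hΘ Λ
    have hle := h.le_of_nonneg hδ hΛ
    -- For `j ≥ 2` the target phase is at least `3π / 2`, out of reach of `Θ Λ`.
    have hj2 : (2 : ℝ) ≤ (j : ℕ) := by exact_mod_cast (show (1 : ℕ) < j from hj)
    rw [← e]
    nlinarith

theorem mainTheorem5 (n : ℕ) :
    ∃ lam : ℝ → ℕ+ → ℝ,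
      (∀ δ : ℝ, 1 < δ →
        Set.range (lam δ) = {μ : ℝ | IsRadialNeumannEigenvalue n δ μ} ∧
        0 ≤ lam δ 1 ∧
        StrictMono (lam δ) ∧
        Tendsto (lam δ) atTop atTop) ∧
      Tendsto (fun δ : ℝ => lam δ 1) (𝓝[>] 1) (𝓝 ((n : ℝ) ^ 2)) ∧
      (∀ j : ℕ+, 1 < j → Tendsto (fun δ : ℝ => lam δ j) (𝓝[>] 1) atTop) ∧
      (1 ≤ n → ∀ δ : ℝ, 1 < δ → (n : ℝ) ^ 2 / δ ^ 2 < lam δ 1) ∧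
      (n = 0 → ∀ δ : ℝ, 1 < δ → lam δ 1 = 0) := by
  have hex : ∀ δ : ℝ, ∃ lam : ℕ+ → ℝ, 1 < δ →
      Set.range lam = {μ : ℝ | IsRadialNeumannEigenvalue n δ μ} ∧
      StrictMono lam ∧ Tendsto lam atTop atTop ∧
      (n : ℝ) ^ 2 / δ ^ 2 ≤ lam 1 ∧ (1 ≤ n → (n : ℝ) ^ 2 / δ ^ 2 < lam 1) ∧
      lam 1 ≤ (n : ℝ) ^ 2 ∧
      ∀ Λ : ℝ, 0 ≤ Λ → (1 + Λ * δ) * (δ - 1) < Real.pi → ∀ j : ℕ+, 1 < j → Λ < lam j := fun δ => by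
    by_cases hδ : 1 < δ
    · obtain ⟨lam, h⟩ := exists_eigenvalue_enumeration n hδ
      exact ⟨lam, fun _ => h⟩
    · exact ⟨fun _ => 0, fun h => absurd h hδ⟩
  choose lam hlam using hex
  refine ⟨lam, fun δ hδ => ?_, ?_, fun j hj => ?_, fun hn δ hδ => ?_, fun hn δ hδ => ?_⟩
  · obtain ⟨h1, h2, h3, h4, -⟩ := hlam δ hδ
    exact ⟨h1, le_trans (by positivity) h4, h2, h3⟩
  · have hc : Tendsto (fun δ : ℝ => (n : ℝ) ^ 2 / δ ^ 2) (𝓝[>] 1) (𝓝 ((n : ℝ) ^ 2)) := by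
      have : ContinuousAt (fun δ : ℝ => (n : ℝ) ^ 2 / δ ^ 2) 1 :=
        continuousAt_const.div (by fun_prop) (by norm_num)
      simpa using this.tendsto.mono_left (nhdsWithin_le_nhds (s := Ioi 1))
    refine tendsto_of_tendsto_of_tendsto_of_le_of_le' hc tendsto_const_nhds ?_ ?_
    · filter_upwards [self_mem_nhdsWithin] with δ hδ using (hlam δ hδ).2.2.2.1
    · filter_upwards [self_mem_nhdsWithin] with δ hδ using (hlam δ hδ).2.2.2.2.2.1
  · refine tendsto_atTop.2 fun b => ?_
    have hc : Continuous fun δ : ℝ => (1 + |b| * δ) * (δ - 1) := by fun_prop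
    have hlt : ∀ᶠ δ in 𝓝[>] (1 : ℝ), (1 + |b| * δ) * (δ - 1) < Real.pi :=
      nhdsWithin_le_nhds ((hc.tendsto 1).eventually_lt_const (by simpa using Real.pi_pos))
    filter_upwards [self_mem_nhdsWithin, hlt] with δ hδ hlt
    exact (le_abs_self b).trans ((hlam δ hδ).2.2.2.2.2.2 |b| (abs_nonneg b) hlt j hj).le
  · exact (hlam δ hδ).2.2.2.2.1 hn
  · obtain ⟨-, -, -, h4, -, h6, -⟩ := hlam δ hδ
    subst hn
    exact le_antisymm (by simpa using h6) (by simpa using h4)
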